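/- For positive integers $m,q$ let $\Delta^{(0)}_{m,q}=[m]$ be the $0$-dimensional simplicial complex with $m$ vertices and, for $n\ge 1$, let $\Delta^{(n)}_{m,q}=\Delta^{(n-1)}_{m,q}*[q]$ be its simplicial join with the $0$-dimensional complex $[q]$ with $q$ vertices. Let $\tilde\beta_{n,k}=\operatorname{rank}\tilde H_k(\Delta^{(n)}_{m,q};\mathbb Z)$ be the rank of the $k$-th reduced simplicial homology group, and let $B_{m,q}=(\tilde\beta_{n,k})_{n,k\ge 0}$, regarded as an infinite matrix over $\mathbb C$. For formal power series $\alpha,\omega\in\mathbb C[[x]]$ with $\omega(0)\ne 0$ let $T(\alpha\mid\omega)=(d_{i,j})_{i,j\ge0}$ be the infinite matrix with entries $d_{i,j}=[x^i]\,\dfrac{x^j\alpha(x)}{\omega(x)^{j+1}}$. A Riordan matrix is an infinite matrix whose columns are the coefficient sequences of the successive terms of a geometric progression in $\mathbb C[[x]]$ with initial term of order $0$ and common ratio of order $1$. (a) If $q\ge 2$, then $$B_{m,q}=T\left(\frac{m-1}{q-1}\;\Big|\;\frac{1}{q-1}\right),$$ and $B_{m,q}$ is a Riordan matrix whenever $m\ge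 2$ (for $m=1$ it is the zero matrix). Consequently, for all $n,k\ge 0$, $\tilde\beta_{n,k}=(m-1)(q-1)^n$ if $n=k$, and $\tilde\beta_{n,k}=0$ if $n\neq k$. (b) If $q=1$, then all entries of $B_{m,1}$ vanish except possibly $\tilde\beta_{0,0}=m-1$; moreover the geometric realization of $\Delta^{(n)}_{m,1}$ is contractible for every $n\ge 1$. -/

import Mathlib

noncomputable section

namespace QCone

open Finset PowerSeries

/-! ### Riordan matrices -/

/-- An infinite matrix is a Riordan matrix if its columns are the coefficients of the successive
terms of a geometric progression of formal power series whose initial term has order `0` and whose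
common ratio has order `1`. -/
def IsRiordan {F : Type*} [Field F] (D : Matrix ℕ ℕ F) : Prop :=
  ∃ f g : PowerSeries F, f.order = 0 ∧ g.order = 1 ∧
    ∀ i j : ℕ, D i j = PowerSeries.coeff i (f * g ^ j)

/-- The matrix `T(α ∣ ω)`, with entries `d i j = [x ^ i] (x ^ j * α) / ω ^ (j + 1)`.
Here `ω` is meant to have a nonzero constant term, so that it is invertible. -/
def riordanT {F : Type*} [Field F] (α ω : PowerSeries F) : Matrix ℕ ℕ F :=
  fun i j => PowerSeries.coeff i (PowerSeries.X ^ j * α * (ω ^ (j + 1))⁻¹)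

/-! ### Joins and iterated `q`-cones

Simplicial complexes are abstract simplicial complexes whose faces are nonempty. Vertices are
linearly ordered, which serves to orient the simplices. -/

/-- The join `K * L = {σ ∪ τ | σ ∈ K ∪ {∅}, τ ∈ L ∪ {∅}}` (without the empty set), on the disjoint
union of the vertex sets, where the vertices of `K` come before those of `L`. -/
def join {V W : Type*} (K : AbstractSimplicialComplex V) (L : AbstractSimplicialComplex W) :
    AbstractSimplicialComplex (V ⊕ₗ W) where
  faces := {s | s.Nonempty ∧ ∃ (σ : Finset V) (τ : Finset W),
    (σ = ∅ ∨ σ ∈ K.faces) ∧ (τ = ∅ ∨ τ ∈ L.faces) ∧ s = (σ.disjSum τ).map toLex.toEmbedding}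
  isRelLowerSet_faces := by
    rintro s ⟨hs, σ, τ, hσ, hτ, rfl⟩
    refine ⟨hs, fun t hts ht => ⟨ht, (t.map ofLex.toEmbedding).toLeft,
      (t.map ofLex.toEmbedding).toRight, ?_, ?_, ?_⟩⟩
    · by_cases h : (t.map ofLex.toEmbedding).toLeft = ∅
      · exact Or.inl h
      · have hsub : (t.map ofLex.toEmbedding).toLeft ⊆ σ := by
          intro v hv
          rw [Finset.mem_toLeft, Finset.mem_map] at hv
          obtain ⟨a, ha, hav⟩ := hv
          have h1 := hts ha
          rw [Finset.mem_map] at h1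
          obtain ⟨b, hb, rfl⟩ := h1
          have : b = Sum.inl v := hav
          subst this
          simpa using hb
        have hne := Finset.nonempty_iff_ne_empty.mpr h
        rcases hσ with rfl | hσ
        · exact absurd (Finset.subset_empty.mp hsub) h
        · exact Or.inr ((K.isRelLowerSet_faces hσ).2 hsub hne)
    · by_cases h : (t.map ofLex.toEmbedding).toRight = ∅
      · exact Or.inl h
      · have hsub : (t.map ofLex.toEmbedding).toRight ⊆ τ := by
          intro v hv
          rw [Finset.mem_toRight, Finset.mem_map] at hv
          obtain ⟨a, ha, hav⟩ := hv
          have h1 := hts ha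
          rw [Finset.mem_map] at h1
          obtain ⟨b, hb, rfl⟩ := h1
          have : b = Sum.inr v := hav
          subst this
          simpa using hb
        have hne := Finset.nonempty_iff_ne_empty.mpr h
        rcases hτ with rfl | hτ
        · exact absurd (Finset.subset_empty.mp hsub) h
        · exact Or.inr ((L.isRelLowerSet_faces hτ).2 hsub hne)
    · rw [Finset.toLeft_disjSum_toRight, Finset.map_map]
      ext a
      simp
  singleton_mem := by
    intro v
    refine ⟨Finset.singleton_nonempty _, ?_⟩
    rcases h : ofLex v with a | b
    · refine ⟨{a}, ∅, Or.inr (K.singleton_mem a), Or.inl rfl, ?_⟩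
      ext x
      rw [← toLex_ofLex v, h]
      simp
    · refine ⟨∅, {b}, Or.inl rfl, Or.inr (L.singleton_mem b), ?_⟩
      ext x
      rw [← toLex_ofLex v, h]
      simp

/-- The `0`-dimensional complex `[k]` with `k` vertices: its faces are exactly the singletons. -/
def points (k : ℕ) : AbstractSimplicialComplex (Fin k) := ⊥

/-- The vertex set of the `n`-th `q`-cone with initial condition `m`. -/
def DeltaVertex (m q : ℕ) : ℕ → Type
  | 0 => Fin m
  | n + 1 => DeltaVertex m q n ⊕ₗ Fin q

instance instLinearOrderDeltaVertex (m q : ℕ) : (n : ℕ) → LinearOrder (DeltaVertex m q n)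
  | 0 => inferInstanceAs (LinearOrder (Fin m))
  | n + 1 =>
    @Sum.Lex.linearOrder (DeltaVertex m q n) (Fin q) (instLinearOrderDeltaVertex m q n) _

instance instFintypeDeltaVertex (m q : ℕ) : (n : ℕ) → Fintype (DeltaVertex m q n)
  | 0 => inferInstanceAs (Fintype (Fin m))
  | n + 1 =>
    letI := instFintypeDeltaVertex m q n
    inferInstanceAs (Fintype (DeltaVertex m q n ⊕ Fin q))

/-- The `n`-th `q`-cone with initial condition `m`: `Δ⁽⁰⁾ = [m]` and `Δ⁽ⁿ⁺¹⁾ = Δ⁽ⁿ⁾ * [q]`. -/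
def Delta (m q : ℕ) : (n : ℕ) → AbstractSimplicialComplex (DeltaVertex m q n)
  | 0 => points m
  | n + 1 => join (Delta m q n) (points q)

/-! ### Reduced simplicial homology with integer coefficients -/

section Homology

variable {V : Type*} [LinearOrder V]

/-- The simplicial boundary operator, on formal integer combinations of finite sets of vertices:
`∂[v₀ < ⋯ < vₖ] = ∑ᵢ (-1)ⁱ [v₀, …, v̂ᵢ, …, vₖ]`. In particular `∂[v] = [∅]`, so that in degree `0`
it is the augmentation, and `∂[∅] = 0`. -/
def boundary (V : Type*) [LinearOrder V] : (Finset V →₀ ℤ) →ₗ[ℤ] (Finset V →₀ ℤ) :=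
  Finsupp.linearCombination ℤ fun s : Finset V =>
    ∑ v ∈ s, (-1 : ℤ) ^ (#{w ∈ s | w < v}) • Finsupp.single (s.erase v) (1 : ℤ)

/-- Augmented simplicial chains of `K` spanned by the faces with `j` vertices, the empty set being
a face with `0` vertices. Thus `chains K (k + 1)` is the group of `k`-chains, and `chains K 0 ≅ ℤ`
is the augmentation. -/
def chains (K : AbstractSimplicialComplex V) (j : ℕ) : Submodule ℤ (Finset V →₀ ℤ) :=
  Finsupp.supported ℤ ℤ {s | s.card = j ∧ (s = ∅ ∨ s ∈ K.faces)}

/-- Reduced `k`-cycles. -/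
def reducedCycles (K : AbstractSimplicialComplex V) (k : ℕ) : Submodule ℤ (Finset V →₀ ℤ) :=
  chains K (k + 1) ⊓ LinearMap.ker (boundary V)

/-- `k`-boundaries. -/
def boundaries (K : AbstractSimplicialComplex V) (k : ℕ) : Submodule ℤ (Finset V →₀ ℤ) :=
  (chains K (k + 2)).map (boundary V)

theorem boundary_single (s : Finset V) : boundary V (Finsupp.single s 1) =
    ∑ v ∈ s, (-1 : ℤ) ^ (#{w ∈ s | w < v}) • Finsupp.single (s.erase v) (1 : ℤ) := by
  simp [boundary]

theorem sign_swap (s : Finset V) {v w : V} (hv : v ∈ s) (hw : w ∈ s) (h : w < v) :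
    (-1 : ℤ) ^ (#{u ∈ s | u < v}) * (-1 : ℤ) ^ (#{u ∈ s.erase v | u < w}) +
    (-1 : ℤ) ^ (#{u ∈ s | u < w}) * (-1 : ℤ) ^ (#{u ∈ s.erase w | u < v}) = 0 := by
  have h1 : ({u ∈ s.erase v | u < w} : Finset V) = {u ∈ s | u < w} := by
    ext u; simp only [mem_filter, mem_erase]; grind
  have h2 : ({u ∈ s.erase w | u < v} : Finset V) = ({u ∈ s | u < v} : Finset V).erase w := by
    ext u; simp only [mem_filter, mem_erase]; tauto
  have h3 : w ∈ ({u ∈ s | u < v} : Finset V) := by simp [hw, h]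
  have h4 := Finset.card_erase_add_one h3
  rw [h1, h2, ← h4, pow_succ]
  ring

/-- The boundary operator squares to zero. -/
theorem boundary_boundary (x : Finset V →₀ ℤ) : boundary V (boundary V x) = 0 := by
  suffices h : (boundary V).comp (boundary V) = 0 from LinearMap.congr_fun h x
  refine Finsupp.lhom_ext' fun s => LinearMap.ext_ring ?_
  simp only [LinearMap.comp_apply, Finsupp.lsingle_apply, LinearMap.zero_apply]
  rw [boundary_single, map_sum]
  simp only [map_zsmul, boundary_single, Finset.smul_sum, smul_smul]
  rw [Finset.sum_sigma']
  refine Finset.sum_involution (fun p _ => ⟨p.2, p.1⟩) ?_ ?_ ?_ ?_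
  · rintro ⟨v, w⟩ hp
    simp only [mem_sigma, mem_erase] at hp
    obtain ⟨hv, hwv, hw⟩ := hp
    dsimp only
    rw [Finset.erase_right_comm (a := w) (b := v), ← add_smul]
    rcases lt_or_gt_of_ne hwv with h | h
    · rw [sign_swap s hv hw h, zero_smul]
    · rw [add_comm, sign_swap s hw hv h, zero_smul]
  · rintro ⟨v, w⟩ hp _ heq
    simp only [mem_sigma, mem_erase] at hp
    simp only [Sigma.mk.injEq, heq_eq_eq] at heq
    exact hp.2.1 heq.1
  · rintro ⟨v, w⟩ hp
    simp only [mem_sigma, mem_erase] at hp ⊢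
    exact ⟨hp.2.2, hp.2.1.symm, hp.1⟩
  · exact fun _ _ => rfl

/-- The boundary of a chain of `K` is a chain of `K`. -/
theorem map_boundary_chains_le (K : AbstractSimplicialComplex V) (j : ℕ) :
    (chains K (j + 1)).map (boundary V) ≤ chains K j := by
  rw [chains, Finsupp.supported_eq_span_single, Submodule.map_span, Submodule.span_le]
  rintro _ ⟨_, ⟨s, ⟨hcard, hs⟩, rfl⟩, rfl⟩
  simp only [SetLike.mem_coe]
  rw [boundary_single]
  refine Submodule.sum_mem _ fun v hv => Submodule.smul_mem _ _ ?_
  refine Finsupp.single_mem_supported ℤ 1 ⟨?_, ?_⟩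
  · rw [Finset.card_erase_of_mem hv, hcard]; rfl
  · rcases hs with rfl | hs
    · simp at hv
    · rcases Finset.eq_empty_or_nonempty (s.erase v) with h | h
      · exact Or.inl h
      · exact Or.inr ((K.isRelLowerSet_faces hs).2 (Finset.erase_subset _ _) h)

/-- Boundaries are cycles. -/
theorem boundaries_le_reducedCycles (K : AbstractSimplicialComplex V) (k : ℕ) :
    boundaries K k ≤ reducedCycles K k := by
  refine le_inf (map_boundary_chains_le K (k + 1)) ?_
  rintro _ ⟨x, _, rfl⟩
  exact boundary_boundary x

/-- The `k`-th reduced simplicial homology group of `K` with integer coefficients. -/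
abbrev ReducedHomology (K : AbstractSimplicialComplex V) (k : ℕ) : Type _ :=
  reducedCycles K k ⧸ (boundaries K k).submoduleOf (reducedCycles K k)

/-- The `k`-th reduced Betti number of `K`. -/
def reducedBetti (K : AbstractSimplicialComplex V) (k : ℕ) : ℕ :=
  Module.finrank ℤ (ReducedHomology K k)

end Homology

/-- The matrix whose `n`-th row lists the reduced Betti numbers of `Δ⁽ⁿ⁾`. -/
def bettiMatrix (m q : ℕ) : Matrix ℕ ℕ ℂ :=
  fun n k => (reducedBetti (Delta m q n) k : ℂ)

/-- The geometric realization of a finite simplicial complex, in barycentric coordinates. -/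
def realization {V : Type*} [Fintype V] (K : AbstractSimplicialComplex V) : Set (V → ℝ) :=
  {x | x ∈ stdSimplex ℝ V ∧ ∃ s ∈ K.faces, Function.support x = (s : Set V)}

end QCone

end

/-!
The result rests on one computation: for every complex `K` and every `r`, the reduced homology of
`K * [r + 1]` in degree `k + 1` is a direct sum of `r` copies of the reduced homology of `K` in
degree `k` (`coneHomologyEquiv`).

A face of `K * [q]` is a face of `K` together with at most one of the `q` apexes, so a chain of the
join is uniquely `z = a + ∑ᵢ bᵢ * i`, with `a` and the `bᵢ` chains of `K` (`eq_joinMap_add_sum`).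
As apexes come after the vertices of `K`, the boundary is
`∂z = (∂a ± ∑ᵢ bᵢ) + ∑ᵢ (∂bᵢ) * i` (`boundary_joinMap_add_sum`). Hence `z` is a cycle exactly if
all `bᵢ` are cycles and `∂a = ∓ ∑ᵢ bᵢ`. The map sending a cycle `z` to the classes of `b₁, …, b_r`,
leaving out `b₀`, is onto: take `a = 0` and `b₀ = -(b₁ + ⋯ + b_r)`. Its kernel consists of the
boundaries: if `bᵢ = ∂yᵢ` for `i ≥ 1`, then `z` is the boundary of `∑ᵢ yᵢ * i` with
`y₀ = ± a - (y₁ + ⋯ + y_r)` (`mem_augBoundaries_join_iff`).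

The argument includes reduced homology in degree `-1`, which vanishes for a complex with a vertex.
Starting from `m` points, whose only reduced homology is `ℤ ^ (m - 1)` in degree `0`, induction
shows that the reduced homology of the `n`-th `q`-cone is free of rank `(m - 1) * (q - 1) ^ n` in
degree `n` and zero in all other degrees (`nonempty_augHomology_delta_equiv`). The Betti matrix is
therefore diagonal with geometric entries, and so is `T(α ∣ ω)` for constant `α` and `ω`.
For `q = 1` the realization is a cone, star-shaped about its apex.
-/

noncomputable section

namespace QCone

open Finset

/-! ### Faces and chains of a join -/

section Join

variable {V W : Type*}

/-- The face `σ ∪ τ` of a join, for vertex sets `σ` and `τ` of its two factors. -/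
def joinFace (τ : Finset W) (σ : Finset V) : Finset (V ⊕ₗ W) :=
  (σ.disjSum τ).map toLex.toEmbedding

theorem joinFace_inj {σ σ' : Finset V} {τ τ' : Finset W} :
    joinFace τ σ = joinFace τ' σ' ↔ σ = σ' ∧ τ = τ' := by
  rw [joinFace, joinFace, Finset.map_inj]
  exact Finset.disjSum_inj

theorem joinFace_injective (τ : Finset W) :
    Function.Injective (joinFace τ : Finset V → Finset (V ⊕ₗ W)) :=
  fun _ _ h => (joinFace_inj.mp h).1

theorem card_joinFace (σ : Finset V) (τ : Finset W) :
    #(joinFace τ σ) = #σ + #τ := by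
  simp [joinFace]

theorem joinFace_eq_empty {σ : Finset V} {τ : Finset W} :
    joinFace τ σ = ∅ ↔ σ = ∅ ∧ τ = ∅ := by
  simp [joinFace]

theorem joinFace_mem_join {K : AbstractSimplicialComplex V} {L : AbstractSimplicialComplex W}
    {σ : Finset V} {τ : Finset W} :
    (joinFace τ σ = ∅ ∨ joinFace τ σ ∈ (join K L).faces) ↔
      (σ = ∅ ∨ σ ∈ K.faces) ∧ (τ = ∅ ∨ τ ∈ L.faces) := by
  constructor
  · rintro (h | ⟨-, σ', τ', hσ, hτ, h⟩)
    · rw [joinFace_eq_empty] at h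
      exact ⟨Or.inl h.1, Or.inl h.2⟩
    · obtain ⟨rfl, rfl⟩ := joinFace_inj.mp h
      exact ⟨hσ, hτ⟩
  · rintro ⟨hσ, hτ⟩
    rw [or_iff_not_imp_left]
    exact fun h => ⟨Finset.nonempty_iff_ne_empty.mpr h, σ, τ, hσ, hτ, rfl⟩

theorem mem_points {q : ℕ} {τ : Finset (Fin q)} : τ ∈ (points q).faces ↔ ∃ i, τ = {i} := by
  simp [points, Bot.bot]

/-- The linear extension of `σ ↦ σ ∪ τ` to chains. -/
def joinMap (τ : Finset W) : (Finset V →₀ ℤ) →ₗ[ℤ] (Finset (V ⊕ₗ W) →₀ ℤ) :=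
  Finsupp.lmapDomain ℤ ℤ (joinFace τ)

/-- The linear map that reads off, from a chain of a join, the coefficients of the faces `σ ∪ τ`
with `τ` fixed. -/
def joinCoord (τ : Finset W) : (Finset (V ⊕ₗ W) →₀ ℤ) →ₗ[ℤ] (Finset V →₀ ℤ) :=
  Finsupp.lcomapDomain (joinFace τ) (joinFace_injective τ)

@[simp]
theorem joinMap_single (τ : Finset W) (σ : Finset V) (c : ℤ) :
    joinMap τ (Finsupp.single σ c) = Finsupp.single (joinFace τ σ) c := by
  simp [joinMap]

theorem joinCoord_joinMap_self (τ : Finset W) (x : Finset V →₀ ℤ) :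
    joinCoord τ (joinMap τ x) = x :=
  Finsupp.leftInverse_lcomapDomain_mapDomain _ (joinFace_injective τ) x

theorem joinCoord_joinMap_of_ne {τ τ' : Finset W} (h : τ ≠ τ') (x : Finset V →₀ ℤ) :
    joinCoord τ (joinMap τ' x) = 0 := by
  ext σ
  refine Finsupp.mapDomain_of_notMem_range x _ ?_
  rintro ⟨σ', hσ'⟩
  exact h (joinFace_inj.mp hσ').2.symm

theorem joinMap_mem_chains {K : AbstractSimplicialComplex V} {L : AbstractSimplicialComplex W}
    {τ : Finset W} (hτ : τ = ∅ ∨ τ ∈ L.faces) {j : ℕ} {x : Finset V →₀ ℤ}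
    (hx : x ∈ chains K j) : joinMap τ x ∈ chains (join K L) (j + #τ) := by
  rw [chains, Finsupp.supported_eq_span_single] at hx
  suffices h : Submodule.span ℤ ((fun i => Finsupp.single i (1 : ℤ)) ''
      {s : Finset V | #s = j ∧ (s = ∅ ∨ s ∈ K.faces)}) ≤
      (chains (join K L) (j + #τ)).comap (joinMap τ) from h hx
  rw [Submodule.span_le]
  rintro _ ⟨s, ⟨hs, hsK⟩, rfl⟩
  simp only [SetLike.mem_coe, Submodule.mem_comap, joinMap_single]
  exact Finsupp.single_mem_supported ℤ 1
    ⟨by rw [card_joinFace, hs], joinFace_mem_join.mpr ⟨hsK, hτ⟩⟩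

theorem joinCoord_mem_chains {K : AbstractSimplicialComplex V} {L : AbstractSimplicialComplex W}
    {τ : Finset W} {j : ℕ} {z : Finset (V ⊕ₗ W) →₀ ℤ}
    (hz : z ∈ chains (join K L) (j + #τ)) : joinCoord τ z ∈ chains K j := by
  rw [chains, Finsupp.mem_supported] at hz ⊢
  intro σ hσ
  have h : joinFace τ σ ∈ z.support := by
    simpa [joinCoord] using hσ
  obtain ⟨hc, hf⟩ := hz h
  rw [card_joinFace] at hc
  exact ⟨by omega, (joinFace_mem_join.mp hf).1⟩

/-- A chain of `K * [q]` is the sum of a chain of `K` and of cones over chains of `K`. -/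
theorem eq_joinMap_add_sum {K : AbstractSimplicialComplex V} {q j : ℕ}
    {z : Finset (V ⊕ₗ Fin q) →₀ ℤ} (hz : z ∈ chains (join K (points q)) j) :
    z = joinMap ∅ (joinCoord ∅ z) + ∑ i, joinMap {i} (joinCoord {i} z) := by
  rw [chains, Finsupp.supported_eq_span_single] at hz
  let f : (Finset (V ⊕ₗ Fin q) →₀ ℤ) →ₗ[ℤ] (Finset (V ⊕ₗ Fin q) →₀ ℤ) :=
    joinMap ∅ ∘ₗ joinCoord ∅ + ∑ i, joinMap {i} ∘ₗ joinCoord {i}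
  have hf (y) : f y = joinMap ∅ (joinCoord ∅ y) + ∑ i, joinMap {i} (joinCoord {i} y) := by
    simp [f]
  rw [← hf]
  refine LinearMap.eqOn_span' (f := LinearMap.id) (g := f) ?_ hz
  rintro _ ⟨s, ⟨-, hs⟩, rfl⟩
  obtain ⟨σ, τ, hτ, rfl⟩ : ∃ σ τ, (τ = ∅ ∨ τ ∈ (points q).faces) ∧ s = joinFace τ σ := by
    rcases hs with rfl | ⟨-, σ, τ, -, hτ, rfl⟩
    · exact ⟨∅, ∅, Or.inl rfl, by simp [joinFace]⟩
    · exact ⟨σ, τ, hτ, rfl⟩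
  simp only [← joinMap_single, LinearMap.id_apply, hf]
  rw [mem_points] at hτ
  rcases hτ with rfl | ⟨i, rfl⟩
  · rw [joinCoord_joinMap_self, Finset.sum_eq_zero, add_zero]
    intro i _
    rw [joinCoord_joinMap_of_ne (Finset.singleton_ne_empty i), map_zero]
  · rw [joinCoord_joinMap_of_ne (Finset.singleton_ne_empty i).symm, map_zero, zero_add,
      Finset.sum_eq_single i, joinCoord_joinMap_self]
    · intro k _ hk
      rw [joinCoord_joinMap_of_ne (by simpa using hk), map_zero]
    · simp

/-! ### The boundary operator on a join -/

/-- The linear map that multiplies every generator `σ` by `(-1) ^ #σ`. -/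
def signMap (V : Type*) : (Finset V →₀ ℤ) →ₗ[ℤ] (Finset V →₀ ℤ) :=
  Finsupp.linearCombination ℤ fun σ : Finset V => (-1 : ℤ) ^ #σ • Finsupp.single σ (1 : ℤ)

theorem signMap_single (σ : Finset V) :
    signMap V (Finsupp.single σ 1) = (-1 : ℤ) ^ #σ • Finsupp.single σ (1 : ℤ) := by
  simp [signMap]

theorem signMap_of_mem_chains {K : AbstractSimplicialComplex V} {j : ℕ} {x : Finset V →₀ ℤ}
    (hx : x ∈ chains K j) : signMap V x = (-1 : ℤ) ^ j • x := by
  rw [chains, Finsupp.supported_eq_span_single] at hx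
  refine LinearMap.eqOn_span' (f := signMap V) (g := (-1 : ℤ) ^ j • LinearMap.id) ?_ hx
  rintro _ ⟨s, ⟨rfl, -⟩, rfl⟩
  exact signMap_single s

theorem joinFace_erase_inl [DecidableEq V] [DecidableEq (V ⊕ₗ W)] (σ : Finset V)
    (τ : Finset W) (v : V) :
    (joinFace τ σ).erase (toLex (Sum.inl v)) = joinFace τ (σ.erase v) := by
  ext a
  rcases h : ofLex a with b | b <;> rw [← toLex_ofLex a, h] <;> simp [joinFace]

theorem joinFace_erase_inr [DecidableEq W] [DecidableEq (V ⊕ₗ W)] (σ : Finset V)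
    (τ : Finset W) (w : W) :
    (joinFace τ σ).erase (toLex (Sum.inr w)) = joinFace (τ.erase w) σ := by
  ext a
  rcases h : ofLex a with b | b <;> rw [← toLex_ofLex a, h] <;> simp [joinFace]

variable [LinearOrder V] [LinearOrder W]

theorem card_lt_inl (σ : Finset V) (τ : Finset W) (v : V) :
    #{a ∈ joinFace τ σ | a < toLex (Sum.inl v)} = #{u ∈ σ | u < v} := by
  rw [← add_zero #{u ∈ σ | u < v}, ← Finset.card_empty (α := W), ← card_joinFace]
  congr 1
  ext a
  rcases h : ofLex a with b | b <;> rw [← toLex_ofLex a, h] <;> simp [joinFace]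

theorem card_lt_inr (σ : Finset V) (τ : Finset W) (w : W) :
    #{a ∈ joinFace τ σ | a < toLex (Sum.inr w)} = #σ + #{u ∈ τ | u < w} := by
  rw [← card_joinFace]
  congr 1
  ext a
  rcases h : ofLex a with b | b <;> rw [← toLex_ofLex a, h] <;> simp [joinFace]

theorem boundary_single_joinFace (σ : Finset V) (τ : Finset W) :
    boundary (V ⊕ₗ W) (Finsupp.single (joinFace τ σ) 1) =
      joinMap τ (boundary V (Finsupp.single σ 1)) +
        ∑ w ∈ τ, (-1 : ℤ) ^ (#σ + #{u ∈ τ | u < w}) •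
          Finsupp.single (joinFace (τ.erase w) σ) (1 : ℤ) := by
  rw [boundary_single, boundary_single, map_sum]
  nth_rw 1 [joinFace]
  rw [Finset.sum_map, Finset.sum_disjSum]
  congr 1
  · refine Finset.sum_congr rfl fun v _ => ?_
    simp only [Equiv.coe_toEmbedding, map_zsmul, joinMap_single]
    rw [card_lt_inl, joinFace_erase_inl]
  · refine Finset.sum_congr rfl fun w _ => ?_
    simp only [Equiv.coe_toEmbedding]
    rw [card_lt_inr, joinFace_erase_inr]

theorem boundary_joinMap_empty (x : Finset V →₀ ℤ) :
    boundary (V ⊕ₗ W) (joinMap ∅ x) = joinMap ∅ (boundary V x) := by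
  refine LinearMap.congr_fun (f := boundary (V ⊕ₗ W) ∘ₗ joinMap ∅)
    (g := joinMap ∅ ∘ₗ boundary V) (Finsupp.lhom_ext' fun σ => LinearMap.ext_ring ?_) x
  simp [boundary_single_joinFace]

/-- The vertices of the second factor of a join come last, so the boundary of the cone over `σ`
with apex `w` is the cone over `∂σ` plus `(-1) ^ #σ • σ`. -/
theorem boundary_joinMap_singleton (w : W) (x : Finset V →₀ ℤ) :
    boundary (V ⊕ₗ W) (joinMap {w} x) =
      joinMap {w} (boundary V x) + joinMap ∅ (signMap V x) := by
  refine LinearMap.congr_fun (f := boundary (V ⊕ₗ W) ∘ₗ joinMap {w})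
    (g := joinMap {w} ∘ₗ boundary V + joinMap ∅ ∘ₗ signMap V)
    (Finsupp.lhom_ext' fun σ => LinearMap.ext_ring ?_) x
  simp [boundary_single_joinFace, signMap_single, Finset.filter_singleton]

end Join

/-! ### The homology of a `q`-cone -/

section ConeHomology

variable {V : Type*} {q : ℕ}

theorem joinCoord_empty_eq (a : Finset V →₀ ℤ) (b : Fin q → (Finset V →₀ ℤ)) :
    joinCoord ∅ (joinMap ∅ a + ∑ i, joinMap {i} (b i)) = a := by
  rw [map_add, joinCoord_joinMap_self, map_sum, Finset.sum_eq_zero, add_zero]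
  exact fun i _ => joinCoord_joinMap_of_ne (Finset.singleton_ne_empty i).symm _

theorem joinCoord_singleton_eq (a : Finset V →₀ ℤ) (b : Fin q → (Finset V →₀ ℤ)) (i : Fin q) :
    joinCoord {i} (joinMap ∅ a + ∑ i, joinMap {i} (b i)) = b i := by
  rw [map_add, joinCoord_joinMap_of_ne (Finset.singleton_ne_empty i), map_sum, zero_add,
    Finset.sum_eq_single i, joinCoord_joinMap_self]
  · exact fun k _ hk => joinCoord_joinMap_of_ne (by simpa using hk.symm) _
  · simp

theorem sum_joinMap_mem_chains {K : AbstractSimplicialComplex V} {j : ℕ}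
    {b : Fin q → (Finset V →₀ ℤ)} (hb : ∀ i, b i ∈ chains K j) :
    ∑ i, joinMap {i} (b i) ∈ chains (join K (points q)) (j + 1) :=
  Submodule.sum_mem _ fun i _ =>
    joinMap_mem_chains (τ := {i}) (Or.inr (mem_points.mpr ⟨i, rfl⟩)) (hb i)

variable [LinearOrder V]

/-- The cycles among the augmented chains spanned by the faces with `j` vertices. -/
def augCycles (K : AbstractSimplicialComplex V) (j : ℕ) : Submodule ℤ (Finset V →₀ ℤ) :=
  chains K j ⊓ LinearMap.ker (boundary V)

/-- The boundaries among the augmented chains spanned by the faces with `j` vertices. -/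
def augBoundaries (K : AbstractSimplicialComplex V) (j : ℕ) : Submodule ℤ (Finset V →₀ ℤ) :=
  (chains K (j + 1)).map (boundary V)

/-- Reduced homology, indexed by the number `j` of vertices of a simplex instead of its dimension,
so that reduced homology in degree `-1` is the case `j = 0`. -/
abbrev AugHomology (K : AbstractSimplicialComplex V) (j : ℕ) : Type _ :=
  augCycles K j ⧸ (augBoundaries K j).submoduleOf (augCycles K j)

theorem boundary_joinMap_add_sum (a : Finset V →₀ ℤ) (b : Fin q → (Finset V →₀ ℤ)) :
    boundary (V ⊕ₗ Fin q) (joinMap ∅ a + ∑ i, joinMap {i} (b i)) =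
      joinMap ∅ (boundary V a + ∑ i, signMap V (b i)) +
        ∑ i, joinMap {i} (boundary V (b i)) := by
  simp only [map_add, map_sum, boundary_joinMap_empty, boundary_joinMap_singleton,
    Finset.sum_add_distrib]
  abel

variable {K : AbstractSimplicialComplex V} {j : ℕ}

theorem joinCoord_singleton_boundary {z : Finset (V ⊕ₗ Fin q) →₀ ℤ}
    (hz : z ∈ chains (join K (points q)) j) (i : Fin q) :
    joinCoord {i} (boundary _ z) = boundary V (joinCoord {i} z) := by
  conv_lhs => rw [eq_joinMap_add_sum hz]
  rw [boundary_joinMap_add_sum, joinCoord_singleton_eq]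

theorem joinCoord_empty_boundary {z : Finset (V ⊕ₗ Fin q) →₀ ℤ}
    (hz : z ∈ chains (join K (points q)) (j + 1)) :
    joinCoord ∅ (boundary _ z) =
      boundary V (joinCoord ∅ z) + (-1 : ℤ) ^ j • ∑ i, joinCoord {i} z := by
  conv_lhs => rw [eq_joinMap_add_sum hz]
  rw [boundary_joinMap_add_sum, joinCoord_empty_eq, Finset.smul_sum]
  congr 1
  exact Finset.sum_congr rfl fun i _ => signMap_of_mem_chains
    (joinCoord_mem_chains (τ := {i}) (by simpa using hz))

theorem joinCoord_mem_augCycles {z : Finset (V ⊕ₗ Fin q) →₀ ℤ}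
    (hz : z ∈ augCycles (join K (points q)) (j + 1)) (i : Fin q) :
    joinCoord {i} z ∈ augCycles K j := by
  refine ⟨joinCoord_mem_chains (τ := {i}) (by simpa using hz.1), ?_⟩
  rw [SetLike.mem_coe, LinearMap.mem_ker, ← joinCoord_singleton_boundary hz.1,
    LinearMap.mem_ker.mp hz.2, map_zero]

theorem sum_joinMap_mem_augCycles {b : Fin q → (Finset V →₀ ℤ)} (hb : ∀ i, b i ∈ augCycles K j)
    (hsum : ∑ i, b i = 0) : ∑ i, joinMap {i} (b i) ∈ augCycles (join K (points q)) (j + 1) := by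
  refine ⟨sum_joinMap_mem_chains fun i => (hb i).1, ?_⟩
  have h := boundary_joinMap_add_sum 0 b
  have hs : ∑ i, signMap V (b i) = 0 := by
    rw [Finset.sum_congr rfl fun i _ => signMap_of_mem_chains (hb i).1, ← Finset.smul_sum, hsum,
      smul_zero]
  simpa [hs, fun i => LinearMap.mem_ker.mp (hb i).2] using h

/-- A cycle of a `q`-cone is a boundary if its components at all apexes but one are: the
component at the remaining apex is then forced to be a boundary by the component in the base. -/
theorem mem_augBoundaries_join_iff {r : ℕ} {z : Finset (V ⊕ₗ Fin (r + 1)) →₀ ℤ}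
    (hz : z ∈ augCycles (join K (points (r + 1))) (j + 1)) :
    z ∈ augBoundaries (join K (points (r + 1))) (j + 1) ↔
      ∀ i : Fin r, joinCoord {i.succ} z ∈ augBoundaries K j := by
  constructor
  · rintro ⟨w, hw, rfl⟩ i
    rw [joinCoord_singleton_boundary hw]
    exact ⟨_, joinCoord_mem_chains (τ := {i.succ}) (by simpa using hw), rfl⟩
  · intro h
    choose y hy hyz using h
    have hz0 := joinCoord_empty_boundary hz.1
    rw [LinearMap.mem_ker.mp hz.2, map_zero, Fin.sum_univ_succ] at hz0
    have ha : joinCoord ∅ z ∈ chains K (j + 1) :=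
      joinCoord_mem_chains (τ := ∅) (by simpa using hz.1)
    have hsq : (-1 : ℤ) ^ (j + 1) * (-1 : ℤ) ^ (j + 1) = 1 := by
      rw [← mul_pow]; simp
    -- `y₀` is chosen so that the boundary of `∑ᵢ yᵢ * i` has the same base component as `z`;
    -- that its component at the first apex is also right follows from `∂z = 0`.
    let y₀ : Finset V →₀ ℤ := (-1 : ℤ) ^ (j + 1) • joinCoord ∅ z - ∑ i, y i
    let Y : Fin (r + 1) → (Finset V →₀ ℤ) := Fin.cons y₀ y
    have hY : ∀ i, Y i ∈ chains K (j + 1) := by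
      refine Fin.cases ?_ hy
      exact Submodule.sub_mem _ (Submodule.smul_mem _ _ ha) (Submodule.sum_mem _ fun i _ => hy i)
    have hYz : ∀ i, boundary V (Y i) = joinCoord {i} z := by
      refine Fin.cases ?_ hyz
      have h1 : boundary V (joinCoord ∅ z) = (-1 : ℤ) ^ (j + 1) •
          (joinCoord {0} z + ∑ i : Fin r, joinCoord {i.succ} z) := by
        rw [eq_neg_of_add_eq_zero_left hz0.symm, pow_succ, mul_neg_one, neg_smul]
      simp only [Y, Fin.cons_zero, y₀, map_sub, map_zsmul, map_sum, hyz]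
      rw [h1, smul_smul, hsq, one_smul, add_sub_cancel_right]
    have hYsum : ∑ i, signMap V (Y i) = joinCoord ∅ z := by
      rw [Finset.sum_congr rfl fun i _ => signMap_of_mem_chains (hY i), ← Finset.smul_sum,
        Fin.sum_univ_succ]
      simp only [Y, Fin.cons_zero, Fin.cons_succ, y₀]
      rw [sub_add_cancel, smul_smul, hsq, one_smul]
    refine ⟨∑ i, joinMap {i} (Y i), sum_joinMap_mem_chains hY, ?_⟩
    have h := boundary_joinMap_add_sum 0 Y
    rw [map_zero, map_zero, zero_add, zero_add, hYsum] at h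
    rw [h, eq_joinMap_add_sum hz.1, joinCoord_empty_eq]
    simp only [hYz]

/-- The homology classes of the components of a cycle of a `q`-cone at all apexes but the first. -/
def coneHomologyMap (K : AbstractSimplicialComplex V) (r j : ℕ) :
    augCycles (join K (points (r + 1))) (j + 1) →ₗ[ℤ] (Fin r → AugHomology K j) :=
  LinearMap.pi fun i => Submodule.mkQ _ ∘ₗ
    (joinCoord {i.succ}).restrict fun _ hz => joinCoord_mem_augCycles hz i.succ

theorem coneHomologyMap_surjective (r : ℕ) : Function.Surjective (coneHomologyMap K r j) := by
  intro y
  choose c hc using fun i => Submodule.mkQ_surjective _ (y i)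
  let b : Fin (r + 1) → (Finset V →₀ ℤ) := Fin.cons (-∑ i, (c i : Finset V →₀ ℤ)) fun i => c i
  have hb : ∀ i, b i ∈ augCycles K j := by
    refine Fin.cases ?_ fun i => (c i).2
    exact Submodule.neg_mem _ (Submodule.sum_mem _ fun i _ => (c i).2)
  have hsum : ∑ i, b i = 0 := by
    rw [Fin.sum_univ_succ]
    simp [b]
  refine ⟨⟨_, sum_joinMap_mem_augCycles hb hsum⟩, funext fun i => ?_⟩
  rw [← hc i]
  refine congrArg (Submodule.mkQ _) (Subtype.ext ?_)
  simpa [b] using joinCoord_singleton_eq 0 b i.succ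

theorem ker_coneHomologyMap (r : ℕ) : LinearMap.ker (coneHomologyMap K r j) =
    (augBoundaries (join K (points (r + 1))) (j + 1)).submoduleOf
      (augCycles (join K (points (r + 1))) (j + 1)) := by
  ext ⟨z, hz⟩
  rw [LinearMap.mem_ker, funext_iff]
  refine Iff.trans ?_ (mem_augBoundaries_join_iff hz).symm
  refine forall_congr' fun i => ?_
  exact Submodule.Quotient.mk_eq_zero _

/-- The homology of `K * [r + 1]` is that of `K` shifted by one degree and repeated `r` times. -/
def coneHomologyEquiv (K : AbstractSimplicialComplex V) (r j : ℕ) :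
    AugHomology (join K (points (r + 1))) (j + 1) ≃ₗ[ℤ] (Fin r → AugHomology K j) :=
  (Submodule.quotEquivOfEq _ _ (ker_coneHomologyMap r).symm).trans
    ((coneHomologyMap K r j).quotKerEquivOfSurjective (coneHomologyMap_surjective r))

/-- A complex with a vertex has no reduced homology in degree `-1`. -/
theorem subsingleton_augHomology_zero [Nonempty V] (K : AbstractSimplicialComplex V) :
    Subsingleton (AugHomology K 0) := by
  rw [Submodule.Quotient.subsingleton_iff, Submodule.submoduleOf_eq_top]
  refine inf_le_left.trans ?_
  rw [chains, Finsupp.supported_eq_span_single, Submodule.span_le]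
  rintro _ ⟨s, ⟨hs, -⟩, rfl⟩
  obtain rfl := Finset.card_eq_zero.mp hs
  obtain ⟨v⟩ := ‹Nonempty V›
  refine ⟨Finsupp.single {v} 1, Finsupp.single_mem_supported ℤ 1
    ⟨Finset.card_singleton v, Or.inr (K.singleton_mem v)⟩, ?_⟩
  rw [boundary_single]
  simp [Finset.filter_singleton]

end ConeHomology

/-! ### The homology of a finite set of points -/

theorem boundary_sum_points {m : ℕ} (c : Fin m → ℤ) :
    boundary (Fin m) (∑ i, Finsupp.single {i} (c i)) = Finsupp.single ∅ (∑ i, c i) := by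
  rw [map_sum, Finsupp.single_finsetSum]
  refine Finset.sum_congr rfl fun i _ => ?_
  rw [← mul_one (c i), ← smul_eq_mul, ← Finsupp.smul_single, map_zsmul, boundary_single]
  simp [Finset.filter_singleton]

theorem eq_sum_of_mem_chains_points {m : ℕ} {x : Finset (Fin m) →₀ ℤ}
    (hx : x ∈ chains (points m) 1) : x = ∑ i, Finsupp.single {i} (x {i}) := by
  ext s
  rw [Finsupp.finsetSum_apply]
  by_cases hs : #s = 1
  · obtain ⟨i, rfl⟩ := Finset.card_eq_one.mp hs
    rw [Finset.sum_eq_single i]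
    · simp
    · exact fun k _ hk => Finsupp.single_eq_of_ne (by simpa using hk.symm)
    · simp
  · rw [Finset.sum_eq_zero]
    · by_contra h
      exact hs (hx (Finsupp.mem_support_iff.mpr h)).1
    · rintro i _
      refine Finsupp.single_eq_of_ne ?_
      rintro rfl
      exact hs (Finset.card_singleton i)

theorem chains_points_eq_bot (m j : ℕ) : chains (points m) (j + 2) = ⊥ := by
  rw [chains, ← Finsupp.supported_empty]
  congr 1
  refine Set.eq_empty_of_forall_notMem ?_
  rintro s ⟨hc, hs⟩
  rw [mem_points] at hs
  rcases hs with rfl | ⟨i, rfl⟩ <;> simp at hc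

/-- A reduced `0`-cycle of a set of points is determined by its coefficients at all points but one,
which are arbitrary, and there are no `0`-boundaries. -/
theorem nonempty_augHomology_points_one (m : ℕ) :
    Nonempty (AugHomology (points (m + 1)) 1 ≃ₗ[ℤ] (Fin m → ℤ)) := by
  have hB : (augBoundaries (points (m + 1)) 1).submoduleOf (augCycles (points (m + 1)) 1) = ⊥ := by
    rw [augBoundaries, chains_points_eq_bot, Submodule.map_bot]
    exact Submodule.ker_subtype _
  let f : augCycles (points (m + 1)) 1 →ₗ[ℤ] (Fin m → ℤ) :=
    LinearMap.pi fun i => Finsupp.lapply {i.succ} ∘ₗ Submodule.subtype _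
  refine ⟨(Submodule.quotEquivOfEqBot _ hB).trans (LinearEquiv.ofBijective f ⟨?_, ?_⟩)⟩
  · rw [← LinearMap.ker_eq_bot, LinearMap.ker_eq_bot']
    rintro ⟨x, hx, hx0⟩ h
    have hs : ∀ i : Fin m, x {i.succ} = 0 := fun i => congrFun h i
    rw [SetLike.mem_coe, LinearMap.mem_ker, eq_sum_of_mem_chains_points hx, boundary_sum_points,
      Fin.sum_univ_succ] at hx0
    simp only [hs, Finset.sum_const_zero, add_zero, Finsupp.single_eq_zero] at hx0
    refine Subtype.ext ?_
    change x = 0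
    rw [eq_sum_of_mem_chains_points hx, Fin.sum_univ_succ]
    simp [hs, hx0]
  · intro y
    let c : Fin (m + 1) → ℤ := Fin.cons (-∑ i, y i) y
    have hc : ∑ i, c i = 0 := by simp [c, Fin.sum_univ_succ]
    refine ⟨⟨∑ i, Finsupp.single {i} (c i), Submodule.sum_mem _ fun i _ =>
      Finsupp.single_mem_supported ℤ _ ⟨Finset.card_singleton i,
        Or.inr (mem_points.mpr ⟨i, rfl⟩)⟩, ?_⟩, funext fun i => ?_⟩
    · rw [SetLike.mem_coe, LinearMap.mem_ker, boundary_sum_points, hc, Finsupp.single_zero]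
    · change (∑ k, Finsupp.single ({k} : Finset (Fin (m + 1))) (c k))
        ({i.succ} : Finset (Fin (m + 1))) = y i
      rw [Finsupp.finsetSum_apply, Finset.sum_eq_single i.succ]
      · simp [c]
      · exact fun k _ hk => Finsupp.single_eq_of_ne (by simpa using hk.symm)
      · simp

theorem subsingleton_augHomology_points (m j : ℕ) :
    Subsingleton (AugHomology (points m) (j + 2)) := by
  have : Subsingleton (augCycles (points m) (j + 2)) := by
    rw [Submodule.subsingleton_iff_eq_bot, eq_bot_iff, ← chains_points_eq_bot m j]
    exact inf_le_left
  exact (Submodule.mkQ_surjective _).subsingleton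

/-! ### The Betti numbers of iterated `q`-cones -/

theorem nonempty_deltaVertex {m : ℕ} (hm : 1 ≤ m) (q : ℕ) :
    (n : ℕ) → Nonempty (DeltaVertex m q n)
  | 0 => ⟨(⟨0, hm⟩ : Fin m)⟩
  | n + 1 => (nonempty_deltaVertex hm q n).map fun v => toLex (Sum.inl v)

/-- The reduced homology of an iterated cone is free and concentrated in degree `n`. An isomorphism
is stated, rather than a rank, so that `coneHomologyEquiv` carries it from `n` to `n + 1`. -/
theorem nonempty_augHomology_delta_equiv (m r n k : ℕ) :
    Nonempty (AugHomology (Delta (m + 1) (r + 1) n) (k + 1) ≃ₗ[ℤ]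
      (Fin (if n = k then m * r ^ n else 0) → ℤ)) := by
  induction n generalizing k with
  | zero =>
    rcases k with _ | k
    · rw [if_pos rfl, pow_zero, mul_one]
      exact nonempty_augHomology_points_one m
    · rw [if_neg (Nat.succ_ne_zero k).symm]
      have : Subsingleton (AugHomology (Delta (m + 1) (r + 1) 0) (k + 1 + 1)) :=
        subsingleton_augHomology_points (m + 1) k
      exact ⟨LinearEquiv.ofSubsingleton _ _⟩
  | succ n ih =>
    let e : AugHomology (Delta (m + 1) (r + 1) (n + 1)) (k + 1) ≃ₗ[ℤ]
      (Fin r → AugHomology (Delta (m + 1) (r + 1) n) k) := coneHomologyEquiv _ r k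
    rcases k with _ | k
    · rw [if_neg (Nat.succ_ne_zero n)]
      have := nonempty_deltaVertex m.succ_pos (r + 1) n
      have := subsingleton_augHomology_zero (Delta (m + 1) (r + 1) n)
      have := e.subsingleton
      exact ⟨LinearEquiv.ofSubsingleton _ _⟩
    · obtain ⟨f⟩ := ih k
      have h : r * (if n = k then m * r ^ n else 0) =
          if n + 1 = k + 1 then m * r ^ (n + 1) else 0 := by
        simp only [Nat.add_right_cancel_iff, mul_ite, mul_zero]
        congr 1
        ring
      rw [← h]
      exact ⟨e.trans ((LinearEquiv.piCongrRight fun _ => f).trans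
        ((LinearEquiv.curry ℤ ℤ _ _).symm.trans
          (LinearEquiv.funCongrLeft ℤ ℤ finProdFinEquiv.symm)))⟩

theorem reducedBetti_delta (m r n k : ℕ) :
    reducedBetti (Delta (m + 1) (r + 1) n) k = if n = k then m * r ^ n else 0 := by
  obtain ⟨e⟩ := nonempty_augHomology_delta_equiv m r n k
  exact e.finrank_eq.trans (Module.finrank_fin_fun ℤ)

/-! ### Riordan matrices with constant data -/

theorem coeff_C_mul_C_mul_X_pow {F : Type*} [Field F] (a b : F) (i j : ℕ) :
    PowerSeries.coeff i (PowerSeries.C a * (PowerSeries.C b * PowerSeries.X) ^ j) =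
      if i = j then a * b ^ i else 0 := by
  rw [mul_pow, ← map_pow, ← mul_assoc, ← map_mul, PowerSeries.coeff_C_mul,
    PowerSeries.coeff_X_pow]
  split_ifs with h
  · rw [h, mul_one]
  · rw [mul_zero]

theorem isRiordan_of_diagonal {F : Type*} [Field F] {a b : F} (ha : a ≠ 0) (hb : b ≠ 0)
    {D : Matrix ℕ ℕ F} (hD : ∀ i j, D i j = if i = j then a * b ^ i else 0) : IsRiordan D := by
  refine ⟨PowerSeries.C a, PowerSeries.C b * PowerSeries.X, ?_, ?_, fun i j => ?_⟩
  · exact PowerSeries.order_zero_of_unit ((ha.isUnit).map PowerSeries.C)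
  · rw [PowerSeries.order_mul, PowerSeries.order_X,
      PowerSeries.order_zero_of_unit ((hb.isUnit).map PowerSeries.C), zero_add]
  · rw [hD, coeff_C_mul_C_mul_X_pow]

theorem riordanT_C_C {F : Type*} [Field F] (a b : F) (hb : b ≠ 0) (i j : ℕ) :
    riordanT (PowerSeries.C (a / b)) (PowerSeries.C (1 / b)) i j =
      if i = j then a * b ^ i else 0 := by
  have hinv : (PowerSeries.C (1 / b) ^ (j + 1) : PowerSeries F)⁻¹ =
      PowerSeries.C (b ^ (j + 1)) := by
    rw [← map_pow, PowerSeries.C_inv, one_div, inv_pow, inv_inv]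
  have h : (PowerSeries.X ^ j * PowerSeries.C (a / b) * PowerSeries.C (b ^ (j + 1)) :
      PowerSeries F) = PowerSeries.C a * (PowerSeries.C b * PowerSeries.X) ^ j := by
    rw [mul_pow, ← map_pow, mul_assoc, ← map_mul, mul_comm, ← mul_assoc, ← map_mul, pow_succ]
    congr 2
    field_simp
  rw [riordanT, hinv, h, coeff_C_mul_C_mul_X_pow]

/-! ### Contractibility of cones -/

/-- The realization of a cone is star-shaped about its apex. -/
theorem contractibleSpace_realization_cone {V : Type*} [Fintype (V ⊕ₗ Fin 1)]
    (K : AbstractSimplicialComplex V) :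
    ContractibleSpace (realization (join K (points 1))) := by
  classical
  let p : V ⊕ₗ Fin 1 := toLex (Sum.inr 0)
  have hp : Pi.single p (1 : ℝ) ∈ realization (join K (points 1)) :=
    ⟨single_mem_stdSimplex ℝ p, {p}, (join K (points 1)).singleton_mem p, by simp⟩
  have hstar : StarConvex ℝ (Pi.single p (1 : ℝ)) (realization (join K (points 1))) := by
    rw [starConvex_iff_forall_pos hp]
    rintro x ⟨hx, s, hs, hxs⟩ a b ha hb hab
    refine ⟨convex_stdSimplex ℝ _ hp.1 hx ha.le hb.le hab, insert p s, ?_, ?_⟩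
    · obtain ⟨-, σ, τ, hσ, hτ, rfl⟩ := hs
      refine ⟨Finset.insert_nonempty _ _, σ, {0}, hσ, Or.inr (mem_points.mpr ⟨0, rfl⟩), ?_⟩
      have h0 : ∀ i : Fin 1, i = 0 := fun i => Subsingleton.elim _ _
      ext v
      rcases h : ofLex v with w | w <;> rw [← toLex_ofLex v, h] <;> simp [p, h0]
    · ext v
      rw [Finset.coe_insert, ← hxs, Set.mem_insert_iff, Function.mem_support, Function.mem_support]
      simp only [Pi.add_apply, Pi.smul_apply, smul_eq_mul]
      by_cases h : v = p
      · subst h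
        have := mul_nonneg hb.le (hx.1 p)
        simp only [Pi.single_eq_same, mul_one, true_or, iff_true]
        positivity
      · simp [h, hb.ne']
  exact hstar.contractibleSpace ⟨_, hp⟩

end QCone

end

theorem mainTheorem11 (m q : ℕ) (hm : 1 ≤ m) (hq : 1 ≤ q) :
    (2 ≤ q →
      (2 ≤ m → QCone.IsRiordan (QCone.bettiMatrix m q)) ∧
      QCone.bettiMatrix m q =
        QCone.riordanT (PowerSeries.C (((m : ℂ) - 1) / ((q : ℂ) - 1)))
          (PowerSeries.C (1 / ((q : ℂ) - 1))) ∧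
      ∀ n k : ℕ, (QCone.reducedBetti (QCone.Delta m q n) k : ℤ) =
        if n = k then ((m : ℤ) - 1) * ((q : ℤ) - 1) ^ n else 0) ∧
    (q = 1 →
      (∀ n k : ℕ, (QCone.reducedBetti (QCone.Delta m q n) k : ℤ) =
        if n = 0 ∧ k = 0 then (m : ℤ) - 1 else 0) ∧
      ∀ n : ℕ, 1 ≤ n → ContractibleSpace (QCone.realization (QCone.Delta m q n))) := by
  obtain ⟨m, rfl⟩ := Nat.exists_eq_add_of_le' hm
  obtain ⟨r, rfl⟩ := Nat.exists_eq_add_of_le' hq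
  refine ⟨fun hr => ?_, fun hr => ?_⟩
  · have hr0 : (r : ℂ) ≠ 0 := Nat.cast_ne_zero.mpr (by omega)
    have hD (i j : ℕ) : QCone.bettiMatrix (m + 1) (r + 1) i j =
        if i = j then (m : ℂ) * (r : ℂ) ^ i else 0 := by
      rw [QCone.bettiMatrix, QCone.reducedBetti_delta]
      push_cast
      rfl
    refine ⟨fun hm2 => ?_, ?_, fun n k => ?_⟩
    · exact QCone.isRiordan_of_diagonal (Nat.cast_ne_zero.mpr (by omega)) hr0 hD
    · ext i j
      push_cast
      rw [add_sub_cancel_right, add_sub_cancel_right, QCone.riordanT_C_C _ _ hr0, hD]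
    · rw [QCone.reducedBetti_delta]
      push_cast
      simp
  · obtain rfl : r = 0 := by omega
    refine ⟨fun n k => ?_, fun n hn => ?_⟩
    · rw [QCone.reducedBetti_delta]
      rcases n with _ | n
      · simp [eq_comm]
      · simp
    · obtain ⟨n, rfl⟩ := Nat.exists_eq_add_of_le' hn
      exact QCone.contractibleSpace_realization_cone (QCone.Delta (m + 1) 1 n)
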